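/- Let $\Phi:[0,\infty)\to[0,\infty)$ be a (strictly) increasing convex function with $\Phi(0)=0$. Assume that $\Phi$ is $C^2$ on $[\Phi^{-1}(1),\infty)$ and that $\sqrt{\Phi}$ is concave on $[0,\infty)$. Let $\Phi'$ denote the right derivative of $\Phi$, and let $$d\mu(x)=Z_\Phi^{-1}e^{-\Phi(|x|)}\,dx,\qquad Z_\Phi=\int_{\mathbb R}e^{-\Phi(|x|)}\,dx .$$ Then $\mu$ is a probability measure on $\mathbb R$, and there exists a constant $c>0$ (depending only on $\Phi$) such that for every $n\ge 1$, every function $h:\mathbb R^n\to\mathbb R$ that is $1$-Lipschitz for the Euclidean distance is $\mu^{\otimes n}$-integrable and, writing $\mu^{\otimes n}(h)=\int h\,d\mu^{\otimes n}$, satisfies $$\mu^{\otimes n}\bigl(\{x:\ h(x)-\mu^{\otimes n}(h)\ge t\sqrt c\,\}\bigr)\le e^{-\sqrt2\,\Phi(t/2)}$$ for every $t\ge\max\bigl(2\Phi^{-1}(1),\,1/\Phi'(\Phi^{-1}(1))\bigr)$. -/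

import Mathlib

open MeasureTheory Set

/-- The normalising constant `Z = ∫ exp (-Φ(|x|)) dx` over the real line. -/
noncomputable def normConst (Φ : ℝ → ℝ) : ℝ :=
  ∫ x : ℝ, Real.exp (-Φ |x|)

/-- The measure `Z⁻¹ exp (-Φ(|x|)) dx` on the real line. -/
noncomputable def potentialMeasure (Φ : ℝ → ℝ) : Measure ℝ :=
  volume.withDensity fun x => ENNReal.ofReal ((normConst Φ)⁻¹ * Real.exp (-Φ |x|))

/-- The `n`-fold product `μ^{⊗n}`, carried by `ℝⁿ` with its Euclidean norm. -/
noncomputable def euclideanPower (μ : Measure ℝ) (n : ℕ) : Measure (EuclideanSpace ℝ (Fin n)) :=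
  (Measure.pi fun _ : Fin n => μ).map (WithLp.toLp 2)

/-- The inverse `Φ⁻¹` of a function `Φ` regarded as a map on `[0, ∞)`. -/
noncomputable def inverseOnNonneg (Φ : ℝ → ℝ) : ℝ → ℝ :=
  Function.invFunOn Φ (Ici 0)

/-- The right derivative of `Φ` at `x`. -/
noncomputable def rightDerivative (Φ : ℝ → ℝ) (x : ℝ) : ℝ :=
  derivWithin Φ (Ioi x) x

open Filter Topology ENNReal

/-! The proof follows Maurey's property (τ): if `F x * G y ≤ exp (c x y)` for all `x`, `y`, then `∫
F * ∫ G ≤ 1`. This property tensorises by adding costs, and it passes to image measures whenever the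
map does not increase the cost.

In dimension one, the half-line exponential law has (τ) with cost `pseudoHuber`, quadratic near 0
and linear at infinity. This is a transport argument in the style of Prékopa–Leindler: the two
quantile functions are combined not at their midpoint but at the midpoint lowered by `pseudoHuber (x
- y)`, and the gain in the weight `exp (-z)` pays for the loss in the arithmetic-geometric mean
inequality (`sqrt_mul_le_exp_neg_mul_barycenter`). The difference of two independent exponential
variables has the Laplace law, and its increasing rearrangement onto `potentialMeasure Φ` contracts
linearly at small scales and like the inverse of `Φ` at large ones (`oddTailExponent_sub`). Hence
`IsConvexPotential.propertyTau`, with cost `potentialCost`.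

In dimension `n`, concavity of `√Φ` makes the sum of the coordinate costs dominate the cost of the
Euclidean norm (`potentialCost_norm_le_sum`), so the constants do not depend on `n`. Applying (τ) to
`exp (a h)` and `exp (-a h)`, then Jensen and Chernoff (`PropertyTau.measure_ge_le`), gives the
deviation bound. -/

/-! ### Quantile functions on the half-line -/

/-- A bounded integrable density on the half-line has a strictly increasing quantile function, which
satisfies the expected differential equation almost everywhere. -/
theorem exists_quantile {p : ℝ → ℝ} {M : ℝ} (hp : Measurable p) (hp0 : ∀ x, 0 ≤ p x)
    (hpM : ∀ x, p x ≤ M) (hint : IntegrableOn p (Ioi 0)) (hU : 0 < ∫ x in Ioi 0, p x) :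
    ∃ q : ℝ → ℝ, MonotoneOn q (Ioo 0 1) ∧ (∀ t ∈ Ioo (0 : ℝ) 1, 0 ≤ q t) ∧
      ∀ᵐ t, t ∈ Ioo (0 : ℝ) 1 →
        ∃ q' : ℝ, 0 ≤ q' ∧ HasDerivAt q q' t ∧ q' * p (q t) = ∫ x in Ioi 0, p x := by
  set U := ∫ x in Ioi 0, p x with hUdef
  have hM : 0 ≤ M := (hp0 0).trans (hpM 0)
  have hbd : ∀ x, ‖p x‖ ≤ M := fun x => by
    rw [Real.norm_of_nonneg (hp0 x)]; exact hpM x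
  have hloc : LocallyIntegrable p volume := by
    have : LocallyIntegrable (fun _ : ℝ => M) volume := locallyIntegrable_const M
    refine this.mono hp.aestronglyMeasurable (ae_of_all _ fun x => ?_)
    rw [Real.norm_of_nonneg hM]; exact hbd x
  have hii : ∀ a b, IntervalIntegrable p volume a b := fun a b =>
    intervalIntegrable_iff.mpr
      ((hloc.integrableOn_isCompact isCompact_uIcc).mono_set uIoc_subset_uIcc)
  set H : ℝ → ℝ := fun x => ∫ y in (0 : ℝ)..x, p y with hH
  have hsub : ∀ x y, H y - H x = ∫ s in x..y, p s := fun x y =>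
    intervalIntegral.integral_interval_sub_left (hii 0 y) (hii 0 x)
  have hmono : Monotone H := fun x y hxy => by
    have := intervalIntegral.integral_nonneg (μ := volume) hxy (fun u _ => hp0 u)
    rw [← hsub] at this; linarith
  have hlip : LipschitzWith M.toNNReal H := by
    refine LipschitzWith.of_dist_le_mul fun x y => ?_
    rw [Real.dist_eq, abs_sub_comm, hsub, Real.dist_eq, abs_sub_comm, Real.coe_toNNReal M hM]
    have := intervalIntegral.norm_integral_le_of_norm_le_const (a := x) (b := y) (f := p) (C := M)
      (fun s _ => hbd s)
    simpa using this
  have hlim : Tendsto H atTop (𝓝 U) :=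
    intervalIntegral_tendsto_integral_Ioi 0 hint tendsto_id
  have hex : ∀ t ∈ Ioo (0 : ℝ) 1, ∃ x, 0 ≤ x ∧ H x = t * U := by
    intro t ht
    have hlt : t * U < U := by nlinarith [ht.2]
    obtain ⟨b, hb, hb0⟩ := ((hlim.eventually (lt_mem_nhds hlt)).and (eventually_ge_atTop 0)).exists
    have h0 : H 0 = 0 := by simp [hH]
    have := intermediate_value_Icc hb0 hlip.continuous.continuousOn
    obtain ⟨x, hx, hxt⟩ := this ⟨by rw [h0]; exact mul_nonneg ht.1.le hU.le, hb.le⟩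
    exact ⟨x, hx.1, hxt⟩
  -- Any selection of preimages under `H` will do: monotonicity of `H` alone forces `q` to be
  -- monotone, hence differentiable almost everywhere.
  choose! q hq0 hq using hex
  have hqmono : MonotoneOn q (Ioo 0 1) := by
    intro s hs t ht hst
    by_contra! hlt
    have h1 := hmono hlt.le
    rw [hq s hs, hq t ht] at h1
    have : s = t := le_antisymm hst (le_of_mul_le_mul_right h1 hU)
    subst this; exact lt_irrefl _ hlt
  refine ⟨q, hqmono, hq0, ?_⟩
  set N : Set ℝ := {x | ¬ HasDerivAt H (p x) x} with hN
  have hNnull : volume N = 0 := by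
    have := LocallyIntegrable.ae_hasDerivAt_integral hloc
    have h2 : ∀ᵐ x, HasDerivAt H (p x) x := this.mono fun x hx => hx 0
    exact h2
  -- `H` is Lipschitz, so it maps the null set `N` where its derivative may fail to be `p` to a null
  -- set. For almost every `t` the point `q t` therefore avoids `N`, and the chain rule applies to
  -- `H ∘ q`.
  have himg : volume (H '' N) = 0 := by
    have h1 := (hlip.lipschitzOnWith (s := N)).hausdorffMeasure_image_le (d := 1) zero_le_one
    rw [hausdorffMeasure_real, hNnull] at h1
    simpa using h1
  have hpre : volume ((fun t : ℝ => t * U) ⁻¹' (H '' N)) = 0 := by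
    rw [Real.volume_preimage_mul_right hU.ne', himg, mul_zero]
  have hae : ∀ᵐ t, t * U ∉ H '' N := by
    rw [ae_iff]; simpa [preimage] using hpre
  filter_upwards [hae, hqmono.ae_differentiableWithinAt_of_mem] with t ht hd htI
  have hnhds : Ioo (0 : ℝ) 1 ∈ 𝓝 t := Ioo_mem_nhds htI.1 htI.2
  have hdt : DifferentiableAt ℝ q t := (hd htI).differentiableAt hnhds
  have hHd : HasDerivAt H (p (q t)) (q t) := by
    by_contra hcon
    exact ht ⟨q t, hcon, hq t htI⟩
  have hcomp := hHd.comp t hdt.hasDerivAt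
  have hlin : HasDerivAt (fun s : ℝ => s * U) U t := by
    simpa using (hasDerivAt_id t).mul_const U
  have heq : H ∘ q =ᶠ[𝓝 t] fun s => s * U := by
    filter_upwards [hnhds] with s hs using hq s hs
  have huniq := (hcomp.congr_of_eventuallyEq heq.symm).unique hlin
  rw [mul_comm] at huniq
  refine ⟨deriv q t, ?_, hdt.hasDerivAt, huniq⟩
  by_contra! hneg
  have := mul_nonpos_of_nonpos_of_nonneg hneg.le (hp0 (q t))
  linarith

/-! ### A transport inequality for the exponential density -/

/-- A smooth even function comparable to `min (s ^ 2) |s|`. -/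
noncomputable def pseudoHuber (s : ℝ) : ℝ := (Real.sqrt (1 + s ^ 2) - 1) / 16

theorem one_le_sqrt_one_add_sq (s : ℝ) : 1 ≤ Real.sqrt (1 + s ^ 2) := by
  rw [Real.one_le_sqrt]; nlinarith [sq_nonneg s]

theorem pseudoHuber_nonneg (s : ℝ) : 0 ≤ pseudoHuber s := by
  unfold pseudoHuber; linarith [one_le_sqrt_one_add_sq s]

theorem hasDerivAt_pseudoHuber (s : ℝ) :
    HasDerivAt pseudoHuber (s / Real.sqrt (1 + s ^ 2) / 16) s := by
  have h0 : (1 : ℝ) + s ^ 2 ≠ 0 := by positivity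
  have h1 : HasDerivAt (fun s : ℝ => 1 + s ^ 2) (2 * s) s := by
    simpa using ((hasDerivAt_pow 2 s).const_add 1)
  have h2 := ((h1.sqrt h0).sub_const 1).div_const 16
  rw [mul_div_mul_left _ _ two_ne_zero] at h2
  exact h2

theorem abs_div_sqrt_one_add_sq_le (s : ℝ) : |s / Real.sqrt (1 + s ^ 2)| ≤ 1 := by
  rw [abs_div, abs_of_nonneg (Real.sqrt_nonneg _)]
  refine div_le_one_of_le₀ ?_ (Real.sqrt_nonneg _)
  exact Real.abs_le_sqrt (by linarith)

theorem pseudoHuber_lipschitz (a b : ℝ) : |pseudoHuber a - pseudoHuber b| ≤ |a - b| / 16 := by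
  have := Convex.norm_image_sub_le_of_norm_hasDerivWithin_le (f := pseudoHuber) (C := 1 / 16)
    (s := univ) (x := b) (y := a)
    (fun x _ => (hasDerivAt_pseudoHuber x).hasDerivWithinAt)
    (fun x _ => by
      rw [Real.norm_eq_abs, abs_div, abs_of_pos (by norm_num : (0 : ℝ) < 16)]
      gcongr; exact abs_div_sqrt_one_add_sq_le x) convex_univ (mem_univ _) (mem_univ _)
  simp only [Real.norm_eq_abs] at this
  linarith

theorem pseudoHuber_zero : pseudoHuber 0 = 0 := by simp [pseudoHuber]

/-- The gain in the arithmetic-geometric mean inequality compensates the shift of the barycentre. -/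
theorem exp_neg_pseudoHuber_le (s : ℝ) :
    Real.exp (-pseudoHuber s) ≤ 1 - 4 * (s / Real.sqrt (1 + s ^ 2) / 16) ^ 2 := by
  set r := Real.sqrt (1 + s ^ 2) with hr
  have h1 : 1 ≤ r := one_le_sqrt_one_add_sq s
  have hsq : r ^ 2 = 1 + s ^ 2 := Real.sq_sqrt (by positivity)
  have e1 : (s / r / 16) ^ 2 = (r ^ 2 - 1) / r ^ 2 / 256 := by
    rw [hsq]; field_simp; rw [hsq]; ring
  have hk : pseudoHuber s = (r - 1) / 16 := rfl
  have hpos : 0 < 1 + (r - 1) / 16 := by linarith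
  have h2 : Real.exp (-pseudoHuber s) ≤ 1 / (1 + (r - 1) / 16) := by
    rw [Real.exp_neg, hk, ← one_div]
    exact one_div_le_one_div_of_le hpos (by linarith [Real.add_one_le_exp ((r - 1) / 16)])
  refine h2.trans ?_
  rw [e1, div_le_iff₀ hpos]
  have hr2 : 0 < r ^ 2 := by positivity
  have e2 : (1 - 4 * ((r ^ 2 - 1) / r ^ 2 / 256)) * (1 + (r - 1) / 16) - 1
      = (r - 1) * (64 * r ^ 2 - (r + 1) * (16 + (r - 1))) / (1024 * r ^ 2) := by
    field_simp; ring
  have : 0 ≤ (r - 1) * (64 * r ^ 2 - (r + 1) * (16 + (r - 1))) / (1024 * r ^ 2) := by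
    apply div_nonneg _ (by positivity)
    apply mul_nonneg (by linarith)
    nlinarith
  linarith

/-- With `k` the cost and `κ` its derivative at `x - y`, the last factor is `(1/2 - κ) x' + (1/2 +
κ) y'`, whose square is at least `(1 - 4κ²) x' y'`. Lowering the midpoint by `k` gains `exp (2k)`
after squaring. One factor `exp k` absorbs `u * v`, the other pays for `1 - 4κ²`. -/
theorem sqrt_mul_le_exp_neg_mul_barycenter {x y x' y' u v : ℝ} (hx' : 0 ≤ x') (hy' : 0 ≤ y')
    (huv : u * v ≤ Real.exp (pseudoHuber (x - y))) :
    Real.sqrt ((x' * (u * Real.exp (-x))) * (y' * (v * Real.exp (-y)))) ≤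
      Real.exp (-((x + y) / 2 - pseudoHuber (x - y))) *
        ((x' + y') / 2 - (x - y) / Real.sqrt (1 + (x - y) ^ 2) / 16 * (x' - y')) := by
  set k := pseudoHuber (x - y) with hk
  set κ := (x - y) / Real.sqrt (1 + (x - y) ^ 2) / 16 with hκ
  have hκ1 : |κ| ≤ 1 / 16 := by
    rw [hκ, abs_div, abs_of_pos (by norm_num : (0 : ℝ) < 16)]
    gcongr; exact abs_div_sqrt_one_add_sq_le _
  have hgain : Real.exp (-k) ≤ 1 - 4 * κ ^ 2 := exp_neg_pseudoHuber_le _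
  obtain ⟨h1, h2⟩ := abs_le.1 hκ1
  have hz : 0 ≤ (x' + y') / 2 - κ * (x' - y') := by nlinarith
  apply Real.sqrt_le_iff.2
  refine ⟨mul_nonneg (Real.exp_pos _).le hz, ?_⟩
  have hsq : (1 - 4 * κ ^ 2) * (x' * y') ≤ ((x' + y') / 2 - κ * (x' - y')) ^ 2 := by
    nlinarith [sq_nonneg ((1 / 2 - κ) * x' - (1 / 2 + κ) * y')]
  have hxy : 0 ≤ x' * y' := mul_nonneg hx' hy'
  have hexp : Real.exp (-((x + y) / 2 - k)) ^ 2
      = Real.exp k * Real.exp k * (Real.exp (-x) * Real.exp (-y)) := by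
    rw [← Real.exp_nat_mul, ← Real.exp_add, ← Real.exp_add, ← Real.exp_add]
    congr 1; push_cast; ring
  have hkk : Real.exp k * Real.exp (-k) = 1 := by rw [← Real.exp_add]; simp
  set E := Real.exp (-x) * Real.exp (-y) with hE
  have hE0 : 0 < E := by positivity
  calc (x' * (u * Real.exp (-x))) * (y' * (v * Real.exp (-y)))
      = (x' * y') * E * (u * v) := by rw [hE]; ring
    _ ≤ (x' * y') * E * Real.exp k := by gcongr
    _ = Real.exp k * Real.exp k * E * (Real.exp (-k) * (x' * y')) := by
        linear_combination (-(x' * y') * E * Real.exp k) * hkk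
    _ ≤ Real.exp k * Real.exp k * E * (((x' + y') / 2 - κ * (x' - y')) ^ 2) := by
        gcongr
        exact (mul_le_mul_of_nonneg_right hgain hxy).trans hsq
    _ = _ := by rw [mul_pow, hexp]

/-- Along the lowered midpoint `z` of the two quantile functions, `-exp (-z)` increases with
derivative at least `√(UV)` almost everywhere, while its total variation over the unit interval is
at most 1. -/
theorem integral_exp_mul_integral_exp_le_one {f g : ℝ → ℝ} {M : ℝ} (hf : Measurable f)
    (hg : Measurable g) (hf0 : ∀ x, 0 ≤ f x) (hg0 : ∀ x, 0 ≤ g x) (hfM : ∀ x, f x ≤ M)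
    (hgM : ∀ x, g x ≤ M) (hfg : ∀ x y, f x * g y ≤ Real.exp (pseudoHuber (x - y))) :
    (∫ x in Ioi 0, f x * Real.exp (-x)) * (∫ y in Ioi 0, g y * Real.exp (-y)) ≤ 1 := by
  have key : ∀ f : ℝ → ℝ, Measurable f → (∀ x, 0 ≤ f x) → (∀ x, f x ≤ M) →
      0 < ∫ x in Ioi 0, f x * Real.exp (-x) →
      ∃ q : ℝ → ℝ, MonotoneOn q (Ioo 0 1) ∧ (∀ t ∈ Ioo (0 : ℝ) 1, 0 ≤ q t) ∧
      ∀ᵐ t, t ∈ Ioo (0 : ℝ) 1 →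
        ∃ q' : ℝ, 0 ≤ q' ∧ HasDerivAt q q' t ∧
          q' * (f (q t) * Real.exp (-q t)) = ∫ x in Ioi 0, f x * Real.exp (-x) := by
    intro f hf hf0 hfM hpos
    -- `exp (-|x|)` replaces `exp (-x)` because `exists_quantile` needs a density bounded on the
    -- whole line.
    have hcongr : ∫ x in Ioi 0, f x * Real.exp (-|x|) = ∫ x in Ioi 0, f x * Real.exp (-x) :=
      setIntegral_congr_fun measurableSet_Ioi fun x (hx : 0 < x) => by
        simp only [abs_of_pos hx]
    have hI : IntegrableOn (fun x => f x * Real.exp (-|x|)) (Ioi 0) := by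
      have h1 : IntegrableOn (fun x : ℝ => M * Real.exp (-x)) (Ioi 0) :=
        (integrableOn_exp_neg_Ioi 0).const_mul M
      refine h1.mono' (by fun_prop) ?_
      filter_upwards [ae_restrict_mem measurableSet_Ioi] with x (hx : 0 < x)
      rw [abs_of_pos hx, norm_mul, Real.norm_of_nonneg (hf0 x),
        Real.norm_of_nonneg (Real.exp_pos _).le]
      gcongr; exact hfM x
    obtain ⟨q, h1, h2, h3⟩ := exists_quantile (p := fun x => f x * Real.exp (-|x|)) (M := M)
      (by fun_prop) (fun x => mul_nonneg (hf0 x) (Real.exp_pos _).le)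
      (fun x => by
        calc f x * Real.exp (-|x|) ≤ f x * 1 := by
              gcongr
              · exact hf0 x
              · exact Real.exp_le_one_iff.2 (neg_nonpos.2 (abs_nonneg x))
          _ ≤ M := by simpa using hfM x) hI (by rwa [hcongr])
    refine ⟨q, h1, h2, ?_⟩
    filter_upwards [h3] with t ht htI
    obtain ⟨q', hq0, hq1, hq2⟩ := ht htI
    refine ⟨q', hq0, hq1, ?_⟩
    rw [abs_of_nonneg (h2 t htI), hcongr] at hq2
    exact hq2
  set U := ∫ x in Ioi 0, f x * Real.exp (-x) with hU
  set V := ∫ x in Ioi 0, g x * Real.exp (-x) with hV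
  have hU0 : 0 ≤ U := integral_nonneg fun x => mul_nonneg (hf0 x) (Real.exp_pos _).le
  have hV0 : 0 ≤ V := integral_nonneg fun x => mul_nonneg (hg0 x) (Real.exp_pos _).le
  rcases hU0.eq_or_lt with hU1 | hU1
  · rw [← hU1]; simp
  rcases hV0.eq_or_lt with hV1 | hV1
  · rw [← hV1]; simp
  obtain ⟨x, hxm, hx0, hxd⟩ := key f hf hf0 hfM hU1
  obtain ⟨y, hym, hy0, hyd⟩ := key g hg hg0 hgM hV1
  set z : ℝ → ℝ := fun t => (x t + y t) / 2 - pseudoHuber (x t - y t) with hz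
  have hz0 : ∀ t ∈ Ioo (0 : ℝ) 1, 0 ≤ z t := by
    intro t ht
    have h1 := pseudoHuber_lipschitz (x t - y t) 0
    rw [pseudoHuber_zero, sub_zero, sub_zero, abs_of_nonneg (pseudoHuber_nonneg _)] at h1
    have h2 : |x t - y t| ≤ x t + y t :=
      abs_le.2 ⟨by linarith [hx0 t ht], by linarith [hy0 t ht]⟩
    have := hx0 t ht
    have := hy0 t ht
    simp only [hz]; linarith
  have hzm : MonotoneOn z (Ioo 0 1) := by
    intro s hs t ht hst
    have h1 := (abs_le.1 (pseudoHuber_lipschitz (x t - y t) (x s - y s))).2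
    have h2 := hxm hs ht hst
    have h3 := hym hs ht hst
    have h4 : |x t - y t - (x s - y s)| ≤ (x t - x s) + (y t - y s) :=
      abs_le.2 ⟨by linarith, by linarith⟩
    simp only [hz]; linarith
  set φ : ℝ → ℝ := fun t => -Real.exp (-z t) with hφ
  have hφm : MonotoneOn φ (Ioo 0 1) := fun s hs t ht hst =>
    neg_le_neg (Real.exp_le_exp.2 (neg_le_neg (hzm hs ht hst)))
  have hφd : ∀ᵐ t, t ∈ Ioo (0 : ℝ) 1 → Real.sqrt (U * V) ≤ deriv φ t := by
    filter_upwards [hxd, hyd] with t hxt hyt ht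
    obtain ⟨x', hx'0, hx', hxU⟩ := hxt ht
    obtain ⟨y', hy'0, hy', hyV⟩ := hyt ht
    have hzd : HasDerivAt z ((x' + y') / 2 -
        (x t - y t) / Real.sqrt (1 + (x t - y t) ^ 2) / 16 * (x' - y')) t :=
      ((hx'.add hy').div_const 2).sub ((hasDerivAt_pseudoHuber _).comp t (hx'.sub hy'))
    have hd := (hzd.neg.exp).neg
    have : deriv φ t = Real.exp (-z t) * ((x' + y') / 2 -
        (x t - y t) / Real.sqrt (1 + (x t - y t) ^ 2) / 16 * (x' - y')) := by
      have h2 : HasDerivAt φ _ t := hd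
      rw [h2.deriv]; simp only [Pi.neg_apply]; ring
    rw [this, hU, hV, ← hxU, ← hyV]
    exact sqrt_mul_le_exp_neg_mul_barycenter hx'0 hy'0 (hfg _ _)
  -- The quantiles are controlled only inside the open interval, hence the cut-off `ε`. For a
  -- monotone function the integral of the derivative is at most the increment, which is the
  -- direction needed.
  have hab : ∀ ε ∈ Ioo (0 : ℝ) (1 / 2), Real.sqrt (U * V) * (1 - 2 * ε) ≤ 1 := by
    intro ε hε
    have hle : ε ≤ 1 - ε := by linarith [hε.2]
    have hsub : uIcc ε (1 - ε) ⊆ Ioo 0 1 := by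
      rw [uIcc_of_le hle]
      exact fun s hs => ⟨by linarith [hs.1, hε.1], by linarith [hs.2, hε.1]⟩
    have hm := hφm.mono hsub
    have h1 := hm.intervalIntegral_deriv_mem_uIcc
    have hmem1 : ε ∈ Ioo (0 : ℝ) 1 := hsub left_mem_uIcc
    have hmem2 : 1 - ε ∈ Ioo (0 : ℝ) 1 := hsub right_mem_uIcc
    have hinc : φ ε ≤ φ (1 - ε) := hφm hmem1 hmem2 hle
    rw [uIcc_of_le (by linarith)] at h1
    have h2 : φ (1 - ε) - φ ε ≤ 1 := by
      have a1 : Real.exp (-z ε) ≤ 1 := Real.exp_le_one_iff.2 (neg_nonpos.2 (hz0 _ hmem1))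
      have a2 := Real.exp_pos (-z (1 - ε))
      simp only [hφ]; linarith
    have h3 : ∫ _ in ε..(1 - ε), Real.sqrt (U * V) ≤ ∫ t in ε..(1 - ε), deriv φ t := by
      refine intervalIntegral.integral_mono_ae_restrict hle (by simp) hm.intervalIntegrable_deriv ?_
      rw [EventuallyLE, ae_restrict_iff' measurableSet_Icc]
      filter_upwards [hφd] with t ht htI
      exact ht (hsub (by rwa [uIcc_of_le hle]))
    rw [intervalIntegral.integral_const, smul_eq_mul] at h3
    nlinarith [h1.2]
  have hs1 : Real.sqrt (U * V) ≤ 1 := by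
    have hlim : Tendsto (fun ε : ℝ => Real.sqrt (U * V) * (1 - 2 * ε)) (𝓝[>] 0)
        (𝓝 (Real.sqrt (U * V) * (1 - 2 * 0))) :=
      (Continuous.tendsto (by fun_prop) 0).mono_left nhdsWithin_le_nhds
    have := le_of_tendsto hlim
      (Filter.mem_of_superset (Ioo_mem_nhdsGT (by norm_num : (0 : ℝ) < 1 / 2)) hab)
    simpa using this
  rwa [Real.sqrt_le_one] at hs1

/-! ### Property (τ): images and products -/

/-- Maurey's property `(τ)` of a measure with respect to a cost, stated for pairs of functions
instead of infimum convolutions. -/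
def PropertyTau {α : Type*} [MeasurableSpace α] (μ : Measure α) (c : α → α → ℝ) : Prop :=
  ∀ F G : α → ℝ≥0∞, Measurable F → Measurable G →
    (∀ x y, F x * G y ≤ ENNReal.ofReal (Real.exp (c x y))) →
    (∫⁻ x, F x ∂μ) * ∫⁻ y, G y ∂μ ≤ 1

namespace PropertyTau

variable {α β : Type*} [MeasurableSpace α] [MeasurableSpace β] {μ : Measure α} {ν : Measure β}
  {c : α → α → ℝ} {d : β → β → ℝ}

theorem map (h : PropertyTau μ c) {S : α → β} (hS : Measurable S)
    (hd : ∀ x y, d (S x) (S y) ≤ c x y) : PropertyTau (μ.map S) d := by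
  intro F G hF hG hFG
  rw [lintegral_map hF hS, lintegral_map hG hS]
  exact h _ _ (hF.comp hS) (hG.comp hS) fun x y =>
    (hFG _ _).trans (ENNReal.ofReal_le_ofReal (Real.exp_le_exp.2 (hd x y)))

/-- For fixed `y`, `y'`, apply the property of `μ` to the slices, one of them scaled by `exp (-d y
y')`. This is exactly the hypothesis on the partial integrals that the property of `ν` requires. -/
theorem prod [SFinite μ] [SFinite ν] (hμ : PropertyTau μ c) (hν : PropertyTau ν d) :
    PropertyTau (μ.prod ν) fun p q => c p.1 q.1 + d p.2 q.2 := by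
  intro F G hF hG hFG
  rw [lintegral_prod_symm _ hF.aemeasurable, lintegral_prod_symm _ hG.aemeasurable]
  refine hν _ _ hF.lintegral_prod_left' hG.lintegral_prod_left' fun y y' => ?_
  have hpos := Real.exp_pos (d y y')
  have hpos' := Real.exp_pos (-d y y')
  have h1 := hμ (fun x => F (x, y)) (fun x => ENNReal.ofReal (Real.exp (-d y y')) * G (x, y'))
    (by fun_prop) (by fun_prop) fun x x' => by
      calc F (x, y) * (ENNReal.ofReal (Real.exp (-d y y')) * G (x', y'))
          = ENNReal.ofReal (Real.exp (-d y y')) * (F (x, y) * G (x', y')) := by ring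
        _ ≤ ENNReal.ofReal (Real.exp (-d y y')) *
            ENNReal.ofReal (Real.exp (c x x' + d y y')) := by gcongr; exact hFG _ _
        _ = ENNReal.ofReal (Real.exp (c x x')) := by
            rw [← ENNReal.ofReal_mul hpos'.le, ← Real.exp_add]; congr 2; ring
  rw [lintegral_const_mul _ (by fun_prop)] at h1
  calc (∫⁻ x, F (x, y) ∂μ) * ∫⁻ x, G (x, y') ∂μ
      = ENNReal.ofReal (Real.exp (d y y')) * ENNReal.ofReal (Real.exp (-d y y')) *
          ((∫⁻ x, F (x, y) ∂μ) * ∫⁻ x, G (x, y') ∂μ) := by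
        rw [← ENNReal.ofReal_mul hpos.le, ← Real.exp_add]; simp
    _ = ENNReal.ofReal (Real.exp (d y y')) * ((∫⁻ x, F (x, y) ∂μ) *
          (ENNReal.ofReal (Real.exp (-d y y')) * ∫⁻ x, G (x, y') ∂μ)) := by ring
    _ ≤ ENNReal.ofReal (Real.exp (d y y')) * 1 := by gcongr
    _ = _ := mul_one _

theorem pi [SigmaFinite μ] (h : PropertyTau μ c) (n : ℕ) :
    PropertyTau (Measure.pi fun _ : Fin n => μ) fun x y => ∑ i, c (x i) (y i) := by
  induction n with
  | zero =>
    intro F G _ _ hFG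
    have h1 := hFG default default
    simp only [Finset.univ_eq_empty, Finset.sum_empty, Real.exp_zero, ENNReal.ofReal_one] at h1
    rwa [Measure.pi_of_empty _ default, lintegral_dirac, lintegral_dirac]
  | succ n ih =>
    have h1 := (measurePreserving_piFinSuccAbove (fun _ : Fin (n + 1) => μ) 0).symm
    rw [← h1.map_eq]
    refine (h.prod ih).map h1.measurable fun p q => le_of_eq ?_
    rw [Fin.sum_univ_succ]
    rfl

end PropertyTau

/-! ### The half-line exponential law -/

/-- The standard exponential distribution on the half-line. -/
noncomputable def halfExp : Measure ℝ :=
  (volume.restrict (Ioi 0)).withDensity fun x => ENNReal.ofReal (Real.exp (-x))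

theorem halfExp_Ioi {r : ℝ} (hr : 0 ≤ r) : halfExp (Ioi r) = ENNReal.ofReal (Real.exp (-r)) := by
  rw [halfExp, withDensity_apply _ measurableSet_Ioi, Measure.restrict_restrict measurableSet_Ioi,
    Ioi_inter_Ioi, sup_of_le_left hr, ← ofReal_integral_eq_lintegral_ofReal
      (integrableOn_exp_neg_Ioi r) (ae_of_all _ fun x => (Real.exp_pos _).le),
    integral_exp_neg_Ioi]

theorem halfExp_Iic_zero : halfExp (Iic 0) = 0 := by
  rw [halfExp, withDensity_apply _ measurableSet_Iic, Measure.restrict_restrict measurableSet_Iic,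
    inter_comm, Ioi_inter_Iic, Ioc_self, Measure.restrict_empty, lintegral_zero_measure]

instance : IsProbabilityMeasure halfExp := by
  constructor
  rw [← Iic_union_Ioi (a := (0 : ℝ)), measure_union (by simp [disjoint_left]) measurableSet_Ioi,
    halfExp_Iic_zero, halfExp_Ioi le_rfl]
  simp

theorem propertyTau_halfExp : PropertyTau halfExp fun x y => pseudoHuber (x - y) := by
  intro F G hF hG hFG
  have hrep : ∀ (F : ℝ → ℝ≥0∞) (hF : Measurable F) (k : ℕ),
      ∫⁻ x, min (F x) k ∂halfExp =
        ENNReal.ofReal (∫ x in Ioi 0, (min (F x) k).toReal * Real.exp (-x)) := by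
    intro F hF k
    have hfin : ∀ x, min (F x) (k : ℝ≥0∞) ≠ ∞ := fun x =>
      ne_top_of_le_ne_top (ENNReal.natCast_ne_top k) (min_le_right _ _)
    rw [halfExp, lintegral_withDensity_eq_lintegral_mul _ (by fun_prop) (by fun_prop),
      ofReal_integral_eq_lintegral_ofReal]
    · refine lintegral_congr fun x => ?_
      rw [ENNReal.ofReal_mul ENNReal.toReal_nonneg, ENNReal.ofReal_toReal (hfin x), mul_comm]
      rfl
    · refine Integrable.mono' ((integrableOn_exp_neg_Ioi 0).const_mul (k : ℝ)) (by fun_prop)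
        (ae_of_all _ fun x => ?_)
      rw [norm_mul, Real.norm_of_nonneg ENNReal.toReal_nonneg,
        Real.norm_of_nonneg (Real.exp_pos _).le]
      gcongr
      exact ENNReal.toReal_le_of_le_ofReal (Nat.cast_nonneg k) (by simp)
    · exact ae_of_all _ fun x => mul_nonneg ENNReal.toReal_nonneg (Real.exp_pos _).le
  have hk : ∀ k : ℕ, (∫⁻ x, min (F x) k ∂halfExp) * ∫⁻ x, min (G x) k ∂halfExp ≤ 1 := by
    intro k
    rw [hrep F hF, hrep G hG, ← ENNReal.ofReal_mul (integral_nonneg fun x =>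
      mul_nonneg ENNReal.toReal_nonneg (Real.exp_pos _).le), ← ENNReal.ofReal_one]
    refine ENNReal.ofReal_le_ofReal (integral_exp_mul_integral_exp_le_one (M := k)
      (by fun_prop) (by fun_prop) (fun _ => ENNReal.toReal_nonneg) (fun _ => ENNReal.toReal_nonneg)
      (fun x => ENNReal.toReal_le_of_le_ofReal (Nat.cast_nonneg k) (by simp))
      (fun x => ENNReal.toReal_le_of_le_ofReal (Nat.cast_nonneg k) (by simp)) fun x y => ?_)
    rw [← ENNReal.toReal_mul]
    refine ENNReal.toReal_le_of_le_ofReal (Real.exp_pos _).le (le_trans ?_ (hFG x y))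
    gcongr <;> exact min_le_left _ _
  have hlim : ∀ (F : ℝ → ℝ≥0∞), Measurable F →
      Tendsto (fun k : ℕ => ∫⁻ x, min (F x) k ∂halfExp) atTop (𝓝 (∫⁻ x, F x ∂halfExp)) := by
    intro F hF
    refine lintegral_tendsto_of_tendsto_of_monotone (fun k => by fun_prop)
      (ae_of_all _ fun x k l hkl => min_le_min_left _ (by exact_mod_cast hkl)) (ae_of_all _ fun x => ?_)
    have : Tendsto (fun k : ℕ => min (F x) (k : ℝ≥0∞)) atTop (𝓝 (min (F x) ∞)) :=
      tendsto_const_nhds.min ENNReal.tendsto_nat_nhds_top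
    simpa using this
  -- Multiplication on `ℝ≥0∞` is discontinuous at `0 * ∞`, so vanishing integrals are set apart
  -- before passing to the limit in the truncations.
  by_cases hF0 : ∫⁻ x, F x ∂halfExp = 0
  · simp [hF0]
  by_cases hG0 : ∫⁻ x, G x ∂halfExp = 0
  · simp [hG0]
  exact le_of_tendsto' (ENNReal.Tendsto.mul (hlim F hF) (Or.inl hF0) (hlim G hG) (Or.inl hG0)) hk

/-! ### Convex potentials and their tails -/

/-- A strictly increasing convex function on the half-line which vanishes at the origin. -/
structure IsConvexPotential (Φ : ℝ → ℝ) : Prop where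
  mono : StrictMonoOn Φ (Ici 0)
  conv : ConvexOn ℝ (Ici 0) Φ
  zero : Φ 0 = 0

/-- The unnormalised upper tail of the density `exp (-Φ(|x|))`. -/
noncomputable def upperTail (Φ : ℝ → ℝ) (x : ℝ) : ℝ :=
  ∫ y in Ioi x, Real.exp (-Φ |y|)

namespace IsConvexPotential

variable {Φ : ℝ → ℝ}

theorem nonneg (h : IsConvexPotential Φ) {x : ℝ} (hx : 0 ≤ x) : 0 ≤ Φ x := by
  rw [← h.zero]; exact h.mono.monotoneOn self_mem_Ici hx hx

theorem pos (h : IsConvexPotential Φ) {x : ℝ} (hx : 0 < x) : 0 < Φ x := by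
  rw [← h.zero]; exact h.mono self_mem_Ici hx.le hx

theorem le_of_le (h : IsConvexPotential Φ) {x y : ℝ} (hx : 0 ≤ x) (hxy : x ≤ y) : Φ x ≤ Φ y :=
  h.mono.monotoneOn hx (hx.trans hxy) hxy

theorem map_mul_le (h : IsConvexPotential Φ) {θ x : ℝ} (hθ : 0 ≤ θ) (hθ1 : θ ≤ 1) (hx : 0 ≤ x) :
    Φ (θ * x) ≤ θ * Φ x := by
  have := h.conv.2 (x := x) (y := 0) hx self_mem_Ici hθ (sub_nonneg.2 hθ1) (by ring)
  simpa [h.zero] using this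

theorem mul_le_map_mul (h : IsConvexPotential Φ) {θ x : ℝ} (hθ : 1 ≤ θ) (hx : 0 ≤ x) :
    θ * Φ x ≤ Φ (θ * x) := by
  have h0 : 0 < θ := by linarith
  have := h.map_mul_le (θ := θ⁻¹) (x := θ * x) (by positivity) (inv_le_one_of_one_le₀ hθ)
    (by positivity)
  rw [inv_mul_cancel_left₀ h0.ne'] at this
  rwa [le_inv_mul_iff₀ h0] at this

theorem add_le_map_add (h : IsConvexPotential Φ) {x y : ℝ} (hx : 0 ≤ x) (hy : 0 ≤ y) :
    Φ x + Φ y ≤ Φ (x + y) := by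
  rcases (add_nonneg hx hy).eq_or_lt with h0 | h0
  · have hx0 : x = 0 := by linarith
    have hy0 : y = 0 := by linarith
    simp [hx0, hy0, h.zero]
  have h1 := h.map_mul_le (θ := x / (x + y)) (x := x + y) (by positivity)
    (div_le_one_of_le₀ (by linarith) h0.le) h0.le
  have h2 := h.map_mul_le (θ := y / (x + y)) (x := x + y) (by positivity)
    (div_le_one_of_le₀ (by linarith) h0.le) h0.le
  rw [div_mul_cancel₀ _ h0.ne'] at h1 h2
  have h3 : x / (x + y) * Φ (x + y) + y / (x + y) * Φ (x + y) = Φ (x + y) := by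
    field_simp
  linarith

theorem map_add_div_two_le (h : IsConvexPotential Φ) {x y : ℝ} (hx : 0 ≤ x) (hy : 0 ≤ y) :
    Φ ((x + y) / 2) ≤ (Φ x + Φ y) / 2 := by
  have := h.conv.2 (x := x) (y := y) hx hy (show (0 : ℝ) ≤ 1 / 2 by norm_num)
    (show (0 : ℝ) ≤ 1 / 2 by norm_num) (by norm_num)
  simp only [smul_eq_mul] at this
  calc Φ ((x + y) / 2) = Φ (1 / 2 * x + 1 / 2 * y) := by congr 1; ring
    _ ≤ _ := this
    _ = _ := by ring

theorem measurable_abs (h : IsConvexPotential Φ) : Measurable fun x => Φ |x| := by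
  -- Nothing is known of `Φ` on the negative axis; `max x 0` makes it monotone on the whole line.
  have h1 : Monotone fun x => Φ (max x 0) := fun x y hxy =>
    h.le_of_le (le_max_right _ _) (max_le_max_right 0 hxy)
  have h2 := h1.measurable.comp (measurable_id.abs)
  convert h2 using 2 with x
  simp

theorem measurable_exp (h : IsConvexPotential Φ) : Measurable fun x => Real.exp (-Φ |x|) :=
  Real.measurable_exp.comp h.measurable_abs.neg

theorem exp_neg_le (h : IsConvexPotential Φ) {x : ℝ} (hx : 0 ≤ x) :
    Real.exp (-Φ x) ≤ Real.exp (Φ 1) * Real.exp (-Φ 1 * x) := by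
  rw [← Real.exp_add]
  refine Real.exp_le_exp.2 ?_
  rcases le_total 1 x with h1 | h1
  · have := h.mul_le_map_mul h1 zero_le_one
    rw [mul_one] at this
    linarith [h.nonneg zero_le_one]
  · nlinarith [h.nonneg hx, h.nonneg zero_le_one]

theorem integrable_exp (h : IsConvexPotential Φ) : Integrable fun x => Real.exp (-Φ |x|) := by
  have hf : IntegrableOn (fun x => Real.exp (-Φ |x|)) (Ioi 0) := by
    refine Integrable.mono' ((integrableOn_exp_mul_Ioi (a := -Φ 1)
      (neg_lt_zero.2 (h.pos one_pos)) 0).const_mul (Real.exp (Φ 1)))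
      h.measurable_exp.aestronglyMeasurable ?_
    filter_upwards [ae_restrict_mem measurableSet_Ioi] with x (hx : 0 < x)
    rw [Real.norm_of_nonneg (Real.exp_pos _).le, abs_of_pos hx]
    exact h.exp_neg_le hx.le
  have hg : IntegrableOn (fun x => Real.exp (-Φ |x|)) (Iic 0) := by
    rw [← Measure.map_neg_eq_self (volume : Measure ℝ)]
    let m : MeasurableEmbedding fun x : ℝ => -x := (Homeomorph.neg ℝ).measurableEmbedding
    rw [m.integrableOn_map_iff]
    simp_rw [Function.comp_def, abs_neg, neg_preimage, neg_Iic, neg_zero]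
    exact Iff.mpr integrableOn_Ici_iff_integrableOn_Ioi hf
  rw [← integrableOn_univ, ← Iic_union_Ioi (a := (0 : ℝ))]
  exact hg.union hf

theorem upperTail_pos (h : IsConvexPotential Φ) (x : ℝ) : 0 < upperTail Φ x := by
  rw [upperTail, setIntegral_pos_iff_support_of_nonneg_ae
    (ae_of_all _ fun x => (Real.exp_pos _).le) h.integrable_exp.integrableOn]
  have : Function.support (fun y => Real.exp (-Φ |y|)) = univ :=
    eq_univ_of_forall fun y => (Real.exp_pos _).ne'
  rw [this, univ_inter]; simp

theorem normConst_eq (Φ : ℝ → ℝ) : normConst Φ = 2 * upperTail Φ 0 := by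
  rw [normConst, upperTail, integral_comp_abs (f := fun x => Real.exp (-Φ x))]
  congr 1
  exact setIntegral_congr_fun measurableSet_Ioi fun x (hx : 0 < x) => by simp only [abs_of_pos hx]

theorem normConst_pos (h : IsConvexPotential Φ) : 0 < normConst Φ := by
  rw [normConst_eq]; linarith [h.upperTail_pos 0]

theorem isProbabilityMeasure (h : IsConvexPotential Φ) :
    IsProbabilityMeasure (potentialMeasure Φ) := by
  constructor
  rw [potentialMeasure, withDensity_apply _ MeasurableSet.univ, Measure.restrict_univ,
    ← ofReal_integral_eq_lintegral_ofReal (h.integrable_exp.const_mul _)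
      (ae_of_all _ fun x => mul_nonneg (inv_nonneg.2 h.normConst_pos.le) (Real.exp_pos _).le),
    integral_const_mul, ← normConst, inv_mul_cancel₀ h.normConst_pos.ne', ENNReal.ofReal_one]

theorem potentialMeasure_apply (h : IsConvexPotential Φ) {s : Set ℝ} (hs : MeasurableSet s) :
    potentialMeasure Φ s =
      ENNReal.ofReal ((normConst Φ)⁻¹ * ∫ x in s, Real.exp (-Φ |x|)) := by
  rw [potentialMeasure, withDensity_apply _ hs,
    ← ofReal_integral_eq_lintegral_ofReal (h.integrable_exp.integrableOn.const_mul _)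
      (ae_of_all _ fun x => mul_nonneg (inv_nonneg.2 h.normConst_pos.le) (Real.exp_pos _).le),
    integral_const_mul]

/-- Superadditivity of `Φ`, under the integral. This governs the rearrangement at large scales. -/
theorem upperTail_add_le (h : IsConvexPotential Φ) {x u : ℝ} (hx : 0 ≤ x) (hu : 0 ≤ u) :
    upperTail Φ (x + u) ≤ Real.exp (-Φ u) * upperTail Φ x := by
  have h1 : upperTail Φ (x + u) = ∫ y in Ioi x, Real.exp (-Φ |y + u|) := by
    have := (measurePreserving_add_right volume u).setIntegral_preimage_emb
      (measurableEmbedding_addRight u) (fun y => Real.exp (-Φ |y|)) (Ioi (x + u))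
    rw [upperTail, ← this]
    congr 2
    ext y; simp
  rw [h1, upperTail, ← integral_const_mul]
  refine setIntegral_mono_on (h.integrable_exp.comp_add_right u).integrableOn
    (h.integrable_exp.integrableOn.const_mul _) measurableSet_Ioi fun y hy => ?_
  have hy0 : 0 ≤ y := hx.trans (le_of_lt hy)
  rw [← Real.exp_add, abs_of_nonneg hy0, abs_of_nonneg (add_nonneg hy0 hu)]
  exact Real.exp_le_exp.2 (by linarith [h.add_le_map_add hy0 hu])

theorem upperTail_sub (h : IsConvexPotential Φ) {x y : ℝ} (hxy : x ≤ y) :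
    upperTail Φ x - upperTail Φ y = ∫ s in x..y, Real.exp (-Φ |s|) :=
  intervalIntegral.integral_Ioi_sub_Ioi h.integrable_exp.integrableOn hxy

theorem continuous_upperTail (h : IsConvexPotential Φ) : Continuous (upperTail Φ) := by
  have h1 : upperTail Φ = fun x => upperTail Φ 0 - ∫ s in (0 : ℝ)..x, Real.exp (-Φ |s|) := by
    funext x
    rcases le_total 0 x with hx | hx
    · rw [← h.upperTail_sub hx]; ring
    · rw [intervalIntegral.integral_symm, ← h.upperTail_sub hx]; ring
  rw [h1]
  exact continuous_const.sub
    (intervalIntegral.continuous_primitive (fun a b => h.integrable_exp.intervalIntegrable) 0)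

/-- The mass between `x` and `x + u` is at least `u * exp (-Φ (x + u))`, and the tail beyond `x + u`
is at most that exponential times `upperTail Φ 0`. This governs small scales, where `Φ` itself may
be too flat. -/
theorem one_add_mul_upperTail_le (h : IsConvexPotential Φ) {x u : ℝ} (hx : 0 ≤ x) (hu : 0 ≤ u) :
    (1 + u / upperTail Φ 0) * upperTail Φ (x + u) ≤ upperTail Φ x := by
  have h0 := h.upperTail_pos 0
  have h1 : u * Real.exp (-Φ (x + u)) ≤ upperTail Φ x - upperTail Φ (x + u) := by
    rw [h.upperTail_sub (by linarith)]
    have : ∫ _ in x..(x + u), Real.exp (-Φ (x + u)) ≤ ∫ s in x..(x + u), Real.exp (-Φ |s|) := by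
      refine intervalIntegral.integral_mono_on (by linarith) (by simp)
        h.integrable_exp.intervalIntegrable fun s hs => ?_
      have hs0 : 0 ≤ s := hx.trans hs.1
      rw [abs_of_nonneg hs0]
      exact Real.exp_le_exp.2 (neg_le_neg (h.le_of_le hs0 hs.2))
    simpa using this
  have h2 := h.upperTail_add_le le_rfl (add_nonneg hx hu)
  rw [zero_add] at h2
  have h3 : u / upperTail Φ 0 * upperTail Φ (x + u) ≤ u * Real.exp (-Φ (x + u)) := by
    rw [div_mul_eq_mul_div, div_le_iff₀ h0, mul_assoc]
    gcongr
  linarith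

end IsConvexPotential

/-! ### The monotone rearrangement -/

/-- The increasing map which carries the half-line part of the measure with potential `Φ` to the
standard exponential distribution. -/
noncomputable def tailExponent (Φ : ℝ → ℝ) (x : ℝ) : ℝ :=
  Real.log (upperTail Φ 0 / upperTail Φ x)

/-- The odd extension of `tailExponent`. -/
noncomputable def oddTailExponent (Φ : ℝ → ℝ) (x : ℝ) : ℝ :=
  if 0 ≤ x then tailExponent Φ x else -tailExponent Φ (-x)

namespace IsConvexPotential

variable {Φ : ℝ → ℝ}

theorem exp_neg_tailExponent (h : IsConvexPotential Φ) (x : ℝ) :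
    Real.exp (-tailExponent Φ x) = upperTail Φ x / upperTail Φ 0 := by
  rw [Real.exp_neg, tailExponent, Real.exp_log (div_pos (h.upperTail_pos _) (h.upperTail_pos _)),
    inv_div]

theorem tailExponent_zero (h : IsConvexPotential Φ) : tailExponent Φ 0 = 0 := by
  rw [tailExponent, div_self (h.upperTail_pos 0).ne', Real.log_one]

theorem exp_tailExponent_sub (h : IsConvexPotential Φ) (x y : ℝ) :
    Real.exp (tailExponent Φ x - tailExponent Φ y) = upperTail Φ y / upperTail Φ x := by
  have := h.upperTail_pos 0
  have := h.upperTail_pos x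
  have := h.upperTail_pos y
  rw [tailExponent, tailExponent, Real.exp_sub, Real.exp_log (by positivity),
    Real.exp_log (by positivity)]
  field_simp

theorem le_tailExponent_sub (h : IsConvexPotential Φ) {x y : ℝ} (hy : 0 ≤ y) (hyx : y ≤ x) :
    Φ (x - y) ≤ tailExponent Φ x - tailExponent Φ y := by
  have h1 := h.upperTail_add_le hy (sub_nonneg.2 hyx)
  rw [add_sub_cancel] at h1
  rw [← Real.exp_le_exp, h.exp_tailExponent_sub, le_div_iff₀ (h.upperTail_pos x)]
  calc Real.exp (Φ (x - y)) * upperTail Φ x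
      ≤ Real.exp (Φ (x - y)) * (Real.exp (-Φ (x - y)) * upperTail Φ y) := by gcongr
    _ = upperTail Φ y := by rw [← mul_assoc, ← Real.exp_add]; simp

theorem one_add_div_le_exp (h : IsConvexPotential Φ) {x y : ℝ} (hy : 0 ≤ y) (hyx : y ≤ x) :
    1 + (x - y) / upperTail Φ 0 ≤ Real.exp (tailExponent Φ x - tailExponent Φ y) := by
  have h1 := h.one_add_mul_upperTail_le hy (sub_nonneg.2 hyx)
  rw [add_sub_cancel] at h1
  rwa [h.exp_tailExponent_sub, le_div_iff₀ (h.upperTail_pos x)]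

/-- The chord of `exp` over `[0, 2]` has slope at most 4, since `exp 2 ≤ 9`. -/
theorem exp_le_one_add_four_mul {D : ℝ} (h0 : 0 ≤ D) (h2 : D ≤ 2) : Real.exp D ≤ 1 + 4 * D := by
  have h1 := convexOn_exp.2 (mem_univ 2) (mem_univ 0) (show 0 ≤ D / 2 by linarith)
    (show 0 ≤ 1 - D / 2 by linarith) (by ring)
  simp only [smul_eq_mul, Real.exp_zero, mul_one, mul_zero, add_zero] at h1
  have h3 : Real.exp 2 ≤ 9 := by
    have : Real.exp 2 = Real.exp 1 ^ 2 := by rw [← Real.exp_nat_mul]; norm_num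
    rw [this]
    nlinarith [Real.exp_one_lt_d9, Real.exp_pos 1]
  rw [div_mul_cancel₀ _ two_ne_zero] at h1
  nlinarith

theorem sub_le_of_tailExponent_sub_le (h : IsConvexPotential Φ) {x y : ℝ} (hy : 0 ≤ y)
    (hyx : y ≤ x) (hD : tailExponent Φ x - tailExponent Φ y ≤ 2) :
    x - y ≤ 4 * upperTail Φ 0 * (tailExponent Φ x - tailExponent Φ y) := by
  have h1 := h.one_add_div_le_exp hy hyx
  have h0 := h.upperTail_pos 0
  have hD0 := (h.nonneg (sub_nonneg.2 hyx)).trans (h.le_tailExponent_sub hy hyx)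
  have h2 := h1.trans (exp_le_one_add_four_mul hD0 hD)
  have h3 : (x - y) / upperTail Φ 0 ≤ 4 * (tailExponent Φ x - tailExponent Φ y) := by linarith
  rw [div_le_iff₀ h0] at h3
  linarith

theorem le_tailExponent (h : IsConvexPotential Φ) {x : ℝ} (hx : 0 ≤ x) : Φ x ≤ tailExponent Φ x := by
  have := h.le_tailExponent_sub le_rfl hx
  rwa [sub_zero, h.tailExponent_zero, sub_zero] at this

theorem le_of_tailExponent_le (h : IsConvexPotential Φ) {x : ℝ} (hx : 0 ≤ x)
    (hD : tailExponent Φ x ≤ 2) : x ≤ 4 * upperTail Φ 0 * tailExponent Φ x := by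
  have := h.sub_le_of_tailExponent_sub_le le_rfl hx
  rw [sub_zero, h.tailExponent_zero, sub_zero] at this
  exact this hD

theorem oddTailExponent_of_nonneg {x : ℝ} (hx : 0 ≤ x) :
    oddTailExponent Φ x = tailExponent Φ x := if_pos hx

theorem oddTailExponent_of_nonpos (h : IsConvexPotential Φ) {x : ℝ} (hx : x ≤ 0) :
    oddTailExponent Φ x = -tailExponent Φ (-x) := by
  rcases hx.eq_or_lt with rfl | hx
  · rw [oddTailExponent_of_nonneg le_rfl, neg_zero, h.tailExponent_zero, neg_zero]
  · exact if_neg (not_le.2 hx)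

/-- The two scales of contraction of the inverse map. The halves come from points of opposite sign,
where the contributions of the two half-lines are combined by midpoint convexity. -/
theorem oddTailExponent_sub (h : IsConvexPotential Φ) {x y : ℝ} (hyx : y ≤ x) :
    Φ ((x - y) / 2) ≤ (oddTailExponent Φ x - oddTailExponent Φ y) / 2 ∧
      (oddTailExponent Φ x - oddTailExponent Φ y ≤ 2 →
        x - y ≤ 4 * upperTail Φ 0 * (oddTailExponent Φ x - oddTailExponent Φ y)) := by
  have hhalf : ∀ u : ℝ, 0 ≤ u → Φ (u / 2) ≤ Φ u / 2 := fun u hu => by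
    have := h.map_add_div_two_le hu le_rfl
    rwa [add_zero, h.zero, add_zero] at this
  rcases le_total 0 y with hy | hy
  · rw [oddTailExponent_of_nonneg hy, oddTailExponent_of_nonneg (hy.trans hyx)]
    refine ⟨?_, h.sub_le_of_tailExponent_sub_le hy hyx⟩
    have h1 := h.le_tailExponent_sub hy hyx
    have h2 := hhalf (x - y) (by linarith)
    linarith
  rcases le_total 0 x with hx | hx
  · rw [oddTailExponent_of_nonneg hx, h.oddTailExponent_of_nonpos hy]
    have hy' : 0 ≤ -y := by linarith
    have h1 := h.le_tailExponent hx
    have h2 := h.le_tailExponent hy'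
    have h3 := h.map_add_div_two_le hx hy'
    have h4 := h.nonneg hx
    have h5 := h.nonneg hy'
    refine ⟨?_, fun hD => ?_⟩
    · rw [sub_eq_add_neg x y]; linarith
    · have h6 := h.le_of_tailExponent_le hx (by linarith)
      have h7 := h.le_of_tailExponent_le hy' (by linarith)
      rw [sub_neg_eq_add, mul_add]; linarith
  · rw [h.oddTailExponent_of_nonpos hx, h.oddTailExponent_of_nonpos hy]
    have hx' : 0 ≤ -x := by linarith
    have hxy' : -x ≤ -y := by linarith
    have e1 : -tailExponent Φ (-x) - -tailExponent Φ (-y)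
      = tailExponent Φ (-y) - tailExponent Φ (-x) := by ring
    have e2 : x - y = -y - -x := by ring
    rw [e1, e2]
    refine ⟨?_, h.sub_le_of_tailExponent_sub_le hx' hxy'⟩
    have h1 := h.le_tailExponent_sub hx' hxy'
    have h2 := hhalf (-y - -x) (by linarith)
    linarith

theorem strictMono_oddTailExponent (h : IsConvexPotential Φ) : StrictMono (oddTailExponent Φ) := by
  intro y x hyx
  have h1 := (h.oddTailExponent_sub hyx.le).1
  have h2 := h.pos (x := (x - y) / 2) (by linarith)
  linarith

theorem exists_tailExponent_eq (h : IsConvexPotential Φ) {a : ℝ} (ha : 0 ≤ a) :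
    ∃ x, 0 ≤ x ∧ tailExponent Φ x = a := by
  have hcont : Continuous (tailExponent Φ) :=
    (continuous_const.div h.continuous_upperTail fun x => (h.upperTail_pos x).ne').log
      fun x => (div_pos (h.upperTail_pos _) (h.upperTail_pos _)).ne'
  have h1 := h.pos one_pos
  set b := max 1 (a / Φ 1) with hb
  have hb1 : 1 ≤ b := le_max_left _ _
  have hab : a ≤ tailExponent Φ b := by
    have h2 := h.mul_le_map_mul hb1 zero_le_one
    rw [mul_one] at h2
    have h3 : a ≤ b * Φ 1 := by
      rw [← div_le_iff₀ h1]; exact le_max_right _ _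
    exact h3.trans (h2.trans (h.le_tailExponent (by linarith)))
  obtain ⟨x, hx, hxa⟩ := intermediate_value_Icc (by linarith : (0 : ℝ) ≤ b) hcont.continuousOn
    ⟨by rw [h.tailExponent_zero]; exact ha, hab⟩
  exact ⟨x, hx.1, hxa⟩

theorem surjective_oddTailExponent (h : IsConvexPotential Φ) :
    Function.Surjective (oddTailExponent Φ) := by
  intro a
  rcases le_total 0 a with ha | ha
  · obtain ⟨x, hx, hxa⟩ := h.exists_tailExponent_eq ha
    exact ⟨x, by rw [oddTailExponent_of_nonneg hx, hxa]⟩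
  · obtain ⟨x, hx, hxa⟩ := h.exists_tailExponent_eq (neg_nonneg.2 ha)
    exact ⟨-x, by rw [h.oddTailExponent_of_nonpos (neg_nonpos.2 hx), neg_neg, hxa, neg_neg]⟩

theorem potentialMeasure_Ioi (h : IsConvexPotential Φ) {x : ℝ} (hx : 0 ≤ x) :
    potentialMeasure Φ (Ioi x) = ENNReal.ofReal (Real.exp (-oddTailExponent Φ x) / 2) := by
  rw [h.potentialMeasure_apply measurableSet_Ioi, oddTailExponent_of_nonneg hx,
    h.exp_neg_tailExponent, normConst_eq, ← upperTail, mul_inv]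
  congr 1; ring

theorem potentialMeasure_Iic (h : IsConvexPotential Φ) {x : ℝ} (hx : x ≤ 0) :
    potentialMeasure Φ (Iic x) = ENNReal.ofReal (Real.exp (oddTailExponent Φ x) / 2) := by
  have h1 := integral_comp_neg_Iic x fun y => Real.exp (-Φ |y|)
  simp only [abs_neg] at h1
  rw [h.potentialMeasure_apply measurableSet_Iic, h.oddTailExponent_of_nonpos hx,
    h.exp_neg_tailExponent, normConst_eq, h1, ← upperTail, mul_inv]
  congr 1; ring

end IsConvexPotential

/-! ### The difference of two exponential variables -/

theorem lintegral_halfExp_exp_neg :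
    ∫⁻ q, ENNReal.ofReal (Real.exp (-q)) ∂halfExp = ENNReal.ofReal (1 / 2) := by
  rw [halfExp, lintegral_withDensity_eq_lintegral_mul _ (by fun_prop) (by fun_prop)]
  have : ∀ q : ℝ, ((fun x => ENNReal.ofReal (Real.exp (-x))) *
      fun q => ENNReal.ofReal (Real.exp (-q))) q = ENNReal.ofReal (Real.exp (-2 * q)) := fun q => by
    rw [Pi.mul_apply, ← ENNReal.ofReal_mul (Real.exp_pos _).le, ← Real.exp_add]
    congr 2; ring
  simp_rw [this]
  rw [← ofReal_integral_eq_lintegral_ofReal (integrableOn_exp_mul_Ioi (by norm_num) 0)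
    (ae_of_all _ fun x => (Real.exp_pos _).le), integral_exp_mul_Ioi (by norm_num)]
  simp

theorem ae_halfExp_pos : ∀ᵐ q ∂halfExp, 0 < q := by
  rw [ae_iff]
  simp only [not_lt]
  exact halfExp_Iic_zero

theorem lintegral_halfExp_exp_neg_add (r : ℝ) :
    ∫⁻ q, ENNReal.ofReal (Real.exp (-(q + r))) ∂halfExp = ENNReal.ofReal (Real.exp (-r) / 2) := by
  have : ∀ q : ℝ, ENNReal.ofReal (Real.exp (-(q + r))) =
      ENNReal.ofReal (Real.exp (-r)) * ENNReal.ofReal (Real.exp (-q)) := fun q => by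
    rw [← ENNReal.ofReal_mul (Real.exp_pos _).le, ← Real.exp_add]
    congr 2; ring
  simp_rw [this]
  rw [lintegral_const_mul _ (by fun_prop), lintegral_halfExp_exp_neg,
    ← ENNReal.ofReal_mul (Real.exp_pos _).le]
  congr 1; ring

theorem halfExp_prod_sub_gt {r : ℝ} (hr : 0 ≤ r) :
    (halfExp.prod halfExp) {p | r < p.1 - p.2} = ENNReal.ofReal (Real.exp (-r) / 2) := by
  rw [Measure.prod_apply_symm (measurableSet_lt (by fun_prop) (by fun_prop)),
    ← lintegral_halfExp_exp_neg_add r]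
  refine lintegral_congr_ae ?_
  filter_upwards [ae_halfExp_pos] with q hq
  rw [← halfExp_Ioi (by linarith : 0 ≤ q + r)]
  congr 1
  ext p
  simp [lt_sub_iff_add_lt, add_comm]

theorem halfExp_prod_sub_le {r : ℝ} (hr : r ≤ 0) :
    (halfExp.prod halfExp) {p | p.1 - p.2 ≤ r} = ENNReal.ofReal (Real.exp r / 2) := by
  have h1 := lintegral_halfExp_exp_neg_add (-r)
  rw [neg_neg] at h1
  rw [Measure.prod_apply (measurableSet_le (by fun_prop) (by fun_prop)), ← h1]
  refine lintegral_congr_ae ?_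
  filter_upwards [ae_halfExp_pos] with q hq
  have : NullSingletonClass halfExp := by unfold halfExp; infer_instance
  rw [← halfExp_Ioi (by linarith : 0 ≤ q + -r), measure_congr (Ioi_ae_eq_Ici (μ := halfExp))]
  congr 1
  ext p
  simp only [mem_preimage, mem_ofPred_eq, mem_Ici]
  constructor <;> intro _ <;> linarith

/-! ### Property (τ) for the one-dimensional measure -/

/-- A cost function that is quadratic near the origin and comparable to `Φ` at infinity. -/
noncomputable def potentialCost (Φ : ℝ → ℝ) (d : ℝ) : ℝ :=
  min ((d / (8 * upperTail Φ 0)) ^ 2) (Φ (|d| / 2)) / 48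

theorem min_le_pseudoHuber {r s : ℝ} (hs : 0 ≤ s) (hsr : s ≤ |r|) :
    min (s ^ 2) s / 48 ≤ pseudoHuber r := by
  have h1 : Real.sqrt (1 + s ^ 2) ≤ Real.sqrt (1 + r ^ 2) := by
    apply Real.sqrt_le_sqrt
    have := sq_le_sq' (by linarith [abs_nonneg r]) hsr
    rw [sq_abs] at this; linarith
  have h2 : 1 + min (s ^ 2) s / 3 ≤ Real.sqrt (1 + s ^ 2) := by
    apply Real.le_sqrt_of_sq_le
    have a1 := min_le_left (s ^ 2) s
    have a2 := min_le_right (s ^ 2) s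
    have a3 : 0 ≤ min (s ^ 2) s := le_min (sq_nonneg s) hs
    nlinarith
  unfold pseudoHuber
  linarith

theorem IsConvexPotential.propertyTau {Φ : ℝ → ℝ} (h : IsConvexPotential Φ) :
    PropertyTau (potentialMeasure Φ) fun x y => potentialCost Φ (x - y) := by
  have hprob := h.isProbabilityMeasure
  let e : ℝ ≃o ℝ := h.strictMono_oddTailExponent.orderIsoOfSurjective _ h.surjective_oddTailExponent
  have he : ∀ a, oddTailExponent Φ (e.symm a) = a := fun a => e.apply_symm_apply a
  set S : ℝ × ℝ → ℝ := fun p => e.symm (p.1 - p.2) with hS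
  have hSm : Measurable S := e.symm.monotone.measurable.comp (measurable_fst.sub measurable_snd)
  have hmap : (halfExp.prod halfExp).map S = potentialMeasure Φ := by
    have : IsProbabilityMeasure ((halfExp.prod halfExp).map S) :=
      Measure.isProbabilityMeasure_map hSm.aemeasurable
    refine Measure.ext_of_Iic _ _ fun x => ?_
    have hpre : S ⁻¹' Iic x = {p | p.1 - p.2 ≤ oddTailExponent Φ x} := by
      ext p; exact e.symm_apply_le
    rcases le_total x 0 with hx | hx
    · have h0 : oddTailExponent Φ x ≤ 0 := by
        have := h.strictMono_oddTailExponent.monotone hx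
        rwa [IsConvexPotential.oddTailExponent_of_nonneg le_rfl, h.tailExponent_zero] at this
      rw [Measure.map_apply hSm measurableSet_Iic, hpre, halfExp_prod_sub_le h0,
        h.potentialMeasure_Iic hx]
    · have h0 : 0 ≤ oddTailExponent Φ x := by
        have := h.strictMono_oddTailExponent.monotone hx
        rwa [IsConvexPotential.oddTailExponent_of_nonneg le_rfl, h.tailExponent_zero] at this
      have hpre' : S ⁻¹' Ioi x = {p | oddTailExponent Φ x < p.1 - p.2} := by
        ext p; exact e.lt_symm_apply
      rw [← compl_Ioi, prob_compl_eq_one_sub measurableSet_Ioi,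
        prob_compl_eq_one_sub measurableSet_Ioi, Measure.map_apply hSm measurableSet_Ioi, hpre',
        halfExp_prod_sub_gt h0, h.potentialMeasure_Ioi hx]
  rw [← hmap]
  refine (propertyTau_halfExp.prod propertyTau_halfExp).map hSm fun p q => ?_
  have main : ∀ x y a b : ℝ, y ≤ x → oddTailExponent Φ x - oddTailExponent Φ y ≤ |a| + |b| →
      potentialCost Φ (x - y) ≤ pseudoHuber a + pseudoHuber b := by
    intro x y a b hyx hab
    obtain ⟨h1, h2⟩ := h.oddTailExponent_sub hyx
    -- At least one of `|a|`, `|b|` is at least `s`, so one of the two exponential costs is enough.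
    set s := (oddTailExponent Φ x - oddTailExponent Φ y) / 2 with hs
    have hs0 : 0 ≤ s := (h.nonneg (by linarith)).trans h1
    have h3 : min (s ^ 2) s / 48 ≤ pseudoHuber a + pseudoHuber b := by
      rcases le_total |a| |b| with hle | hle
      · linarith [min_le_pseudoHuber (r := b) hs0 (by linarith), pseudoHuber_nonneg a]
      · linarith [min_le_pseudoHuber (r := a) hs0 (by linarith), pseudoHuber_nonneg b]
    refine le_trans ?_ h3
    have hJ := h.upperTail_pos 0
    unfold potentialCost
    rw [abs_of_nonneg (sub_nonneg.2 hyx)]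
    refine div_le_div_of_nonneg_right ?_ (by norm_num)
    -- If `s ≥ 1`, then `Φ ((x - y) / 2) ≤ s ≤ s ^ 2` suffices. If `s ≤ 1`, the exponents differ by
    -- at most 2 and the linear estimate applies; the `8` in the cost is its `4` times the `2` in `2
    -- * s`.
    rcases le_total 1 s with h1s | h1s
    · refine le_min (le_trans (min_le_right _ _) ?_) ((min_le_right _ _).trans h1)
      nlinarith
    · have h4 := h2 (by linarith)
      have h5 : (x - y) / (8 * upperTail Φ 0) ≤ s := by
        have h2s : oddTailExponent Φ x - oddTailExponent Φ y = 2 * s := by rw [hs]; ring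
        rw [h2s] at h4
        rw [div_le_iff₀ (by positivity)]; linarith
      have h6 : ((x - y) / (8 * upperTail Φ 0)) ^ 2 ≤ s ^ 2 :=
        pow_le_pow_left₀ (div_nonneg (by linarith) (by positivity)) h5 2
      refine le_min ((min_le_left _ _).trans h6) ((min_le_right _ _).trans h1)
  have heq : oddTailExponent Φ (S p) - oddTailExponent Φ (S q) = (p.1 - q.1) - (p.2 - q.2) := by
    rw [hS, he, he]; ring
  have hle : |(p.1 - q.1) - (p.2 - q.2)| ≤ |p.1 - q.1| + |p.2 - q.2| := abs_sub _ _
  rcases le_total (S q) (S p) with hqp | hqp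
  · refine main _ _ _ _ hqp ?_
    rw [heq]; exact (le_abs_self _).trans hle
  · have hsymm : potentialCost Φ (S p - S q) = potentialCost Φ (S q - S p) := by
      unfold potentialCost
      rw [abs_sub_comm, ← neg_sub (S q) (S p), neg_div, neg_sq]
    rw [hsymm]
    refine main _ _ _ _ hqp ?_
    rw [← neg_sub (oddTailExponent Φ (S p)), heq]; exact (neg_le_abs _).trans hle

/-! ### Concavity of the square root and the Euclidean cost -/

namespace IsConvexPotential

variable {Φ : ℝ → ℝ}

theorem sq_mul_le_map_mul (h : IsConvexPotential Φ)
    (hs : ConcaveOn ℝ (Ici 0) fun x => Real.sqrt (Φ x)) {θ x : ℝ} (hθ : 0 ≤ θ) (hθ1 : θ ≤ 1)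
    (hx : 0 ≤ x) : θ ^ 2 * Φ x ≤ Φ (θ * x) := by
  have h1 := hs.2 (x := x) (y := 0) hx self_mem_Ici hθ (sub_nonneg.2 hθ1) (by ring)
  simp only [smul_eq_mul, mul_zero, add_zero, h.zero, Real.sqrt_zero] at h1
  have h2 := pow_le_pow_left₀ (mul_nonneg hθ (Real.sqrt_nonneg _)) h1 2
  rwa [mul_pow, Real.sq_sqrt (h.nonneg hx), Real.sq_sqrt (h.nonneg (mul_nonneg hθ hx))] at h2

theorem potentialCost_nonneg (h : IsConvexPotential Φ) (d : ℝ) : 0 ≤ potentialCost Φ d :=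
  div_nonneg (le_min (sq_nonneg _) (h.nonneg (by positivity))) (by norm_num)

theorem potentialCost_abs (Φ : ℝ → ℝ) (d : ℝ) : potentialCost Φ |d| = potentialCost Φ d := by
  unfold potentialCost
  rw [abs_abs, div_pow, div_pow, sq_abs]

theorem sq_mul_potentialCost_le (h : IsConvexPotential Φ)
    (hs : ConcaveOn ℝ (Ici 0) fun x => Real.sqrt (Φ x)) {θ r : ℝ} (hθ : 0 ≤ θ) (hθ1 : θ ≤ 1)
    (hr : 0 ≤ r) : θ ^ 2 * potentialCost Φ r ≤ potentialCost Φ (θ * r) := by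
  unfold potentialCost
  rw [← mul_div_assoc]
  refine div_le_div_of_nonneg_right ?_ (by norm_num)
  rw [abs_of_nonneg hr, abs_of_nonneg (mul_nonneg hθ hr)]
  refine le_min ?_ ?_
  · calc _ ≤ θ ^ 2 * (r / (8 * upperTail Φ 0)) ^ 2 := by gcongr; exact min_le_left _ _
      _ = _ := by ring
  · calc _ ≤ θ ^ 2 * Φ (r / 2) := by gcongr; exact min_le_right _ _
      _ ≤ Φ (θ * (r / 2)) := h.sq_mul_le_map_mul hs hθ hθ1 (by linarith)
      _ = _ := by rw [mul_div_assoc]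

/-- Both branches of the cost satisfy `w (θ r) ≥ θ² w r` for `θ` in `[0, 1]`; apply this with `θ =
|z i| / ‖z‖`, whose squares sum to 1. -/
theorem potentialCost_norm_le_sum (h : IsConvexPotential Φ)
    (hs : ConcaveOn ℝ (Ici 0) fun x => Real.sqrt (Φ x)) {n : ℕ} (z : EuclideanSpace ℝ (Fin n)) :
    potentialCost Φ ‖z‖ ≤ ∑ i, potentialCost Φ (z i) := by
  rcases (norm_nonneg z).eq_or_lt with h0 | h0
  · rw [← h0]
    have : potentialCost Φ 0 = 0 := by simp [potentialCost, h.zero]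
    rw [this]
    exact Finset.sum_nonneg fun i _ => h.potentialCost_nonneg _
  have hsq : ∑ i, (|z i| / ‖z‖) ^ 2 = 1 := by
    simp_rw [div_pow, sq_abs]
    rw [← Finset.sum_div, ← EuclideanSpace.real_norm_sq_eq, div_self (by positivity)]
  calc potentialCost Φ ‖z‖ = ∑ i, (|z i| / ‖z‖) ^ 2 * potentialCost Φ ‖z‖ := by
        rw [← Finset.sum_mul, hsq, one_mul]
    _ ≤ ∑ i, potentialCost Φ (z i) := by
        refine Finset.sum_le_sum fun i _ => ?_
        have := h.sq_mul_potentialCost_le hs (θ := |z i| / ‖z‖) (r := ‖z‖) (by positivity)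
          (div_le_one_of_le₀ (by simpa using PiLp.norm_apply_le z i) h0.le) h0.le
        rwa [div_mul_cancel₀ _ h0.ne', potentialCost_abs] at this

theorem exists_potentialCost_ge (h : IsConvexPotential Φ)
    (hs : ConcaveOn ℝ (Ici 0) fun x => Real.sqrt (Φ x)) :
    ∃ κ : ℝ, 0 < κ ∧ ∀ s, 0 ≤ s → κ * Φ (s / 2) - κ * Φ 1 ≤ potentialCost Φ s := by
  have h1 := h.pos one_pos
  have hJ := h.upperTail_pos 0
  -- For `s ≥ 2`, concavity of `√Φ` gives `Φ (s / 2) ≤ s ^ 2 / 4 * Φ 1`, and `κ` is small enough for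
  -- the quadratic branch to absorb this. For `s ≤ 2` the left side is nonpositive.
  set κ := min 1 (1 / (16 * upperTail Φ 0 ^ 2 * Φ 1)) / 48 with hκ
  have hκ0 : 0 < κ := div_pos (lt_min one_pos (by positivity)) (by norm_num)
  refine ⟨κ, hκ0, fun s hs0 => ?_⟩
  rcases le_total s 2 with hs2 | hs2
  · have : Φ (s / 2) ≤ Φ 1 := h.le_of_le (by linarith) (by linarith)
    have := mul_le_mul_of_nonneg_left this hκ0.le
    linarith [h.potentialCost_nonneg s]
  have hpos : 0 < s := by linarith
  have h2 := h.sq_mul_le_map_mul hs (θ := 2 / s) (x := s / 2) (by positivity)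
    (div_le_one_of_le₀ hs2 hs0) (by positivity)
  have e : 2 / s * (s / 2) = 1 := by field_simp
  rw [e] at h2
  have h3 : Φ (s / 2) ≤ s ^ 2 / 4 * Φ 1 := by
    calc Φ (s / 2) = s ^ 2 / 4 * ((2 / s) ^ 2 * Φ (s / 2)) := by field_simp; ring
      _ ≤ s ^ 2 / 4 * Φ 1 := by gcongr
  have hΦ := h.nonneg (x := s / 2) (by linarith)
  have h4 : κ * Φ (s / 2) ≤ potentialCost Φ s := by
    unfold potentialCost
    rw [hκ, div_mul_eq_mul_div, abs_of_nonneg hs0]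
    refine div_le_div_of_nonneg_right (le_min ?_ ?_) (by norm_num)
    · calc _ ≤ 1 / (16 * upperTail Φ 0 ^ 2 * Φ 1) * (s ^ 2 / 4 * Φ 1) :=
            mul_le_mul (min_le_right _ _) h3 hΦ (by positivity)
        _ = _ := by field_simp; norm_num
    · calc _ ≤ 1 * Φ (s / 2) := mul_le_mul_of_nonneg_right (min_le_left _ _) hΦ
        _ = _ := one_mul _
  have := mul_pos hκ0 h1
  linarith

theorem propertyTau_euclideanPower (h : IsConvexPotential Φ)
    (hs : ConcaveOn ℝ (Ici 0) fun x => Real.sqrt (Φ x)) (n : ℕ) :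
    PropertyTau (euclideanPower (potentialMeasure Φ) n) fun x y => potentialCost Φ ‖x - y‖ := by
  have := h.isProbabilityMeasure
  refine (h.propertyTau.pi n).map (WithLp.measurable_toLp 2 _) fun x y => ?_
  exact h.potentialCost_norm_le_sum hs (WithLp.toLp 2 x - WithLp.toLp 2 y)

/-- Since `Φ u / u` is nondecreasing, one of the two terms on the right already suffices. This
replaces a Legendre transform: it bounds `a * s - w s` for the slope `a` attached to `r`. -/
theorem slope_mul_le (h : IsConvexPotential Φ) {r s : ℝ} (hr : 0 < r) (hs : 0 ≤ s) :
    Φ (r / 2) / r * s ≤ Φ (r / 2) + Φ (s / 2) := by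
  have h0 := h.nonneg (x := r / 2) (by linarith)
  rcases le_total s r with hsr | hsr
  · have h1 := h.nonneg (x := s / 2) (by linarith)
    have h2 : Φ (r / 2) / r * s ≤ Φ (r / 2) / r * r := by gcongr
    rw [div_mul_cancel₀ _ hr.ne'] at h2
    linarith
  · have h1 := h.mul_le_map_mul (θ := s / r) (x := r / 2) ((one_le_div hr).2 hsr) (by linarith)
    have e1 : s / r * (r / 2) = s / 2 := by field_simp
    have e2 : s / r * Φ (r / 2) = Φ (r / 2) / r * s := by ring
    rw [e1, e2] at h1
    linarith

theorem exists_map_eq_one (h : IsConvexPotential Φ) : ∃ x ∈ Ici (0 : ℝ), Φ x = 1 := by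
  have h1 := h.pos one_pos
  set b := max 1 (1 / Φ 1) with hb
  set a := min 1 (1 / Φ 1) with ha
  have ha0 : 0 < a := lt_min one_pos (by positivity)
  have hab : a ≤ b := (min_le_left _ _).trans (le_max_left _ _)
  -- Convexity gives continuity only in the interior of the half-line, which is why `a` is kept
  -- positive.
  have hcont : ContinuousOn Φ (Icc a b) := by
    refine h.conv.continuousOn_interior.mono ?_
    rw [interior_Ici]
    exact fun x hx => ha0.trans_le hx.1
  have hΦa : Φ a ≤ 1 := by
    have h2 := h.map_mul_le ha0.le (min_le_left _ _) zero_le_one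
    rw [mul_one] at h2
    refine h2.trans ?_
    rw [← le_div_iff₀ h1]; exact min_le_right _ _
  have hΦb : 1 ≤ Φ b := by
    have h2 := h.mul_le_map_mul (le_max_left 1 (1 / Φ 1)) zero_le_one
    rw [mul_one] at h2
    refine le_trans ?_ h2
    rw [← div_le_iff₀ h1]; exact le_max_right _ _
  obtain ⟨x, hx, hx1⟩ := intermediate_value_Icc hab hcont ⟨hΦa, hΦb⟩
  exact ⟨x, ha0.le.trans hx.1, hx1⟩

end IsConvexPotential

/-! ### From property (τ) to deviation inequalities -/

namespace PropertyTau

variable {E : Type*} [NormedAddCommGroup E] [MeasurableSpace E] [BorelSpace E] {P : Measure E}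
  {w : ℝ → ℝ} {h : E → ℝ} {a B : ℝ}

theorem lintegral_exp_mul_le (hP : PropertyTau P fun x y => w ‖x - y‖) (hh : LipschitzWith 1 h)
    (ha : 0 ≤ a) (hB : ∀ s, 0 ≤ s → a * s - w s ≤ B) :
    (∫⁻ x, ENNReal.ofReal (Real.exp (a * h x)) ∂P) *
      ∫⁻ x, ENNReal.ofReal (Real.exp (-(a * h x))) ∂P ≤ ENNReal.ofReal (Real.exp B) := by
  have hm : Measurable h := hh.continuous.measurable
  have h1 := hP (fun x => ENNReal.ofReal (Real.exp (a * h x)))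
    (fun x => ENNReal.ofReal (Real.exp (-B)) * ENNReal.ofReal (Real.exp (-(a * h x))))
    (by fun_prop) (by fun_prop) fun x y => by
      rw [← ENNReal.ofReal_mul (Real.exp_pos _).le, ← ENNReal.ofReal_mul (Real.exp_pos _).le,
        ← Real.exp_add, ← Real.exp_add]
      refine ENNReal.ofReal_le_ofReal (Real.exp_le_exp.2 ?_)
      have h2 : h x - h y ≤ ‖x - y‖ := by
        have := hh.dist_le_mul x y
        rw [NNReal.coe_one, one_mul, Real.dist_eq, dist_eq_norm] at this
        exact (le_abs_self _).trans this
      have h3 := mul_le_mul_of_nonneg_left h2 ha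
      linarith [hB _ (norm_nonneg (x - y))]
  rw [lintegral_const_mul _ (by fun_prop)] at h1
  calc _ = ENNReal.ofReal (Real.exp B) * (ENNReal.ofReal (Real.exp (-B)) *
        ((∫⁻ x, ENNReal.ofReal (Real.exp (a * h x)) ∂P) *
          ∫⁻ x, ENNReal.ofReal (Real.exp (-(a * h x))) ∂P)) := by
        rw [← mul_assoc, ← ENNReal.ofReal_mul (Real.exp_pos _).le, ← Real.exp_add]; simp
    _ = ENNReal.ofReal (Real.exp B) * ((∫⁻ x, ENNReal.ofReal (Real.exp (a * h x)) ∂P) *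
        (ENNReal.ofReal (Real.exp (-B)) *
          ∫⁻ x, ENNReal.ofReal (Real.exp (-(a * h x))) ∂P)) := by ring
    _ ≤ ENNReal.ofReal (Real.exp B) * 1 := by gcongr
    _ = _ := mul_one _

variable [IsProbabilityMeasure P]

theorem integrable_exp_mul (hP : PropertyTau P fun x y => w ‖x - y‖) (hh : LipschitzWith 1 h)
    (ha : 0 ≤ a) (hB : ∀ s, 0 ≤ s → a * s - w s ≤ B) :
    Integrable (fun x => Real.exp (a * h x)) P := by
  have hm : Measurable h := hh.continuous.measurable
  have h1 := hP.lintegral_exp_mul_le hh ha hB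
  have hpos : ∫⁻ x, ENNReal.ofReal (Real.exp (-(a * h x))) ∂P ≠ 0 := by
    rw [Ne, lintegral_eq_zero_iff (by fun_prop)]
    intro h0
    obtain ⟨x, hx⟩ := h0.exists
    simp only [Pi.zero_apply, ENNReal.ofReal_eq_zero] at hx
    exact absurd (Real.exp_pos _) (not_lt.2 hx)
  refine ⟨by fun_prop, ?_⟩
  rw [hasFiniteIntegral_iff_ofReal (ae_of_all _ fun x => (Real.exp_pos _).le), lt_top_iff_ne_top]
  intro htop
  rw [htop, ENNReal.top_mul hpos] at h1
  exact absurd h1 (not_le.2 ENNReal.ofReal_lt_top)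

theorem integrable_exp_neg_mul (hP : PropertyTau P fun x y => w ‖x - y‖)
    (hh : LipschitzWith 1 h) (ha : 0 ≤ a) (hB : ∀ s, 0 ≤ s → a * s - w s ≤ B) :
    Integrable (fun x => Real.exp (-(a * h x))) P := by
  have := hP.integrable_exp_mul hh.neg ha hB
  simpa using this

theorem integrable_of_lipschitz (hP : PropertyTau P fun x y => w ‖x - y‖)
    (hh : LipschitzWith 1 h) (ha : 0 < a) (hB : ∀ s, 0 ≤ s → a * s - w s ≤ B) :
    Integrable h P := by
  have hm : Measurable h := hh.continuous.measurable
  refine Integrable.mono' (((hP.integrable_exp_mul hh ha.le hB).add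
    (hP.integrable_exp_neg_mul hh ha.le hB)).const_mul a⁻¹) hm.aestronglyMeasurable
    (ae_of_all _ fun x => ?_)
  rw [Pi.add_apply, le_inv_mul_iff₀ ha, Real.norm_eq_abs, ← abs_of_pos ha, ← abs_mul,
    abs_of_pos ha]
  refine abs_le.2 ⟨?_, ?_⟩
  · linarith [Real.add_one_le_exp (-(a * h x)), Real.exp_pos (a * h x)]
  · linarith [Real.add_one_le_exp (a * h x), Real.exp_pos (-(a * h x))]

theorem measure_ge_le (hP : PropertyTau P fun x y => w ‖x - y‖) (hh : LipschitzWith 1 h)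
    (ha : 0 < a) (hB : ∀ s, 0 ≤ s → a * s - w s ≤ B) (r : ℝ) :
    P {x | r ≤ h x - ∫ y, h y ∂P} ≤ ENNReal.ofReal (Real.exp (B - a * r)) := by
  have hi := hP.integrable_of_lipschitz hh ha hB
  have hp := hP.integrable_exp_mul hh ha.le hB
  have hn := hP.integrable_exp_neg_mul hh ha.le hB
  set m := ∫ y, h y ∂P with hmdef
  -- Jensen converts the bound on the product of the two Laplace transforms into a bound on the one
  -- at `a`, centred at the mean.
  have hjensen : Real.exp (-(a * m)) ≤ ∫ x, Real.exp (-(a * h x)) ∂P := by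
    have := convexOn_exp.map_integral_le (μ := P) (f := fun x => -(a * h x))
      Real.continuous_exp.continuousOn isClosed_univ (by simp) (hi.const_mul a).neg hn
    rwa [integral_neg, integral_const_mul] at this
  have hprod : (∫ x, Real.exp (a * h x) ∂P) * ∫ x, Real.exp (-(a * h x)) ∂P ≤ Real.exp B := by
    have h1 := hP.lintegral_exp_mul_le hh ha.le hB
    rw [← ofReal_integral_eq_lintegral_ofReal hp (ae_of_all _ fun x => (Real.exp_pos _).le),
      ← ofReal_integral_eq_lintegral_ofReal hn (ae_of_all _ fun x => (Real.exp_pos _).le),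
      ← ENNReal.ofReal_mul (integral_nonneg fun x => (Real.exp_pos _).le)] at h1
    exact (ENNReal.ofReal_le_ofReal_iff (Real.exp_pos _).le).1 h1
  have hmgf : ProbabilityTheory.mgf h P a ≤ Real.exp (B + a * m) := by
    have h0 : 0 ≤ ProbabilityTheory.mgf h P a := ProbabilityTheory.mgf_nonneg
    have h1 : ProbabilityTheory.mgf h P a * Real.exp (-(a * m)) ≤ Real.exp B :=
      (mul_le_mul_of_nonneg_left hjensen h0).trans hprod
    calc ProbabilityTheory.mgf h P a
        = ProbabilityTheory.mgf h P a * Real.exp (-(a * m)) * Real.exp (a * m) := by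
          rw [mul_assoc, ← Real.exp_add]; simp
      _ ≤ Real.exp B * Real.exp (a * m) := by gcongr
      _ = _ := (Real.exp_add _ _).symm
  have hset : {x | r ≤ h x - m} = {x | r + m ≤ h x} := by
    ext x; simp [le_sub_iff_add_le]
  have hch := ProbabilityTheory.measure_ge_le_exp_mul_mgf (r + m) ha.le hp
  rw [hset, ← ofReal_measureReal]
  refine ENNReal.ofReal_le_ofReal (hch.trans ?_)
  calc _ ≤ Real.exp (-a * (r + m)) * Real.exp (B + a * m) := by gcongr
    _ = _ := by rw [← Real.exp_add]; congr 1; ring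

end PropertyTau

/-! ### The concentration inequality -/

theorem mainTheorem12 (Φ : ℝ → ℝ)
    (hmono : StrictMonoOn Φ (Ici 0))
    (hconv : ConvexOn ℝ (Ici 0) Φ)
    (hzero : Φ 0 = 0)
    (hC2 : ContDiffOn ℝ 2 Φ (Ici (inverseOnNonneg Φ 1)))
    (hsqrt : ConcaveOn ℝ (Ici 0) fun x => Real.sqrt (Φ x)) :
    IsProbabilityMeasure (potentialMeasure Φ) ∧
      ∃ c : ℝ, 0 < c ∧
        ∀ n : ℕ, 1 ≤ n →
          ∀ h : EuclideanSpace ℝ (Fin n) → ℝ, LipschitzWith 1 h →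
            Integrable h (euclideanPower (potentialMeasure Φ) n) ∧
            ∀ t : ℝ,
              max (2 * inverseOnNonneg Φ 1)
                  (1 / rightDerivative Φ (inverseOnNonneg Φ 1)) ≤ t →
              euclideanPower (potentialMeasure Φ) n
                  {x | t * Real.sqrt c ≤
                    h x - ∫ y, h y ∂(euclideanPower (potentialMeasure Φ) n)} ≤
                ENNReal.ofReal (Real.exp (-(Real.sqrt 2 * Φ (t / 2)))) := by
  have hΦ : IsConvexPotential Φ := ⟨hmono, hconv, hzero⟩
  have hprob := hΦ.isProbabilityMeasure
  refine ⟨hprob, ?_⟩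
  obtain ⟨κ, hκ, hcost⟩ := hΦ.exists_potentialCost_ge hsqrt
  have h1 := hΦ.pos one_pos
  -- With `r = 2 * K * t` and deviation `6 * K * t`, the exponent is `κ Φ(1) - 2κ Φ(K t)`, at most
  -- `κ Φ(1) - 4κK Φ(t/2)`. The choice of `K`, with `Φ(t/2) ≥ 1`, brings this below `-2 Φ(t/2)`.
  set K := max 1 ((κ * Φ 1 + 2) / (4 * κ)) with hKdef
  have hK1 : 1 ≤ K := le_max_left _ _
  have hK2 : κ * Φ 1 + 2 ≤ K * (4 * κ) := by
    rw [← div_le_iff₀ (by positivity)]; exact le_max_right _ _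
  have hslope : ∀ r, 0 < r → 0 < κ * (Φ (r / 2) / r) ∧
      ∀ s, 0 ≤ s → κ * (Φ (r / 2) / r) * s - potentialCost Φ s ≤ κ * Φ 1 + κ * Φ (r / 2) := by
    intro r hr
    have h2 := hΦ.pos (x := r / 2) (by linarith)
    refine ⟨by positivity, fun s hs => ?_⟩
    have h3 := mul_le_mul_of_nonneg_left (hΦ.slope_mul_le hr hs) hκ.le
    linarith [hcost s hs]
  refine ⟨(6 * K) ^ 2, by positivity, fun n _ h hh => ?_⟩
  have hP : IsProbabilityMeasure (euclideanPower (potentialMeasure Φ) n) :=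
    Measure.isProbabilityMeasure_map (WithLp.measurable_toLp 2 _).aemeasurable
  have hτ := hΦ.propertyTau_euclideanPower hsqrt n
  refine ⟨hτ.integrable_of_lipschitz hh (hslope 1 one_pos).1 (hslope 1 one_pos).2, fun t ht => ?_⟩
  have hinv0 : 0 ≤ inverseOnNonneg Φ 1 := Function.invFunOn_mem hΦ.exists_map_eq_one
  have hinv1 : Φ (inverseOnNonneg Φ 1) = 1 := Function.invFunOn_eq hΦ.exists_map_eq_one
  have ht2 : inverseOnNonneg Φ 1 ≤ t / 2 := by linarith [(le_max_left _ _).trans ht]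
  have hΦt : 1 ≤ Φ (t / 2) := hinv1 ▸ hΦ.le_of_le hinv0 ht2
  have hinvpos : 0 < inverseOnNonneg Φ 1 := by
    rcases hinv0.eq_or_lt with h0 | h0
    · rw [← h0, hzero] at hinv1; norm_num at hinv1
    · exact h0
  have ht0 : 0 < t := by linarith
  have hr : 0 < 2 * K * t := by positivity
  refine (hτ.measure_ge_le hh (hslope _ hr).1 (hslope _ hr).2 _).trans
    (ENNReal.ofReal_le_ofReal (Real.exp_le_exp.2 ?_))
  rw [Real.sqrt_sq (by positivity)]
  have e1 : κ * (Φ (2 * K * t / 2) / (2 * K * t)) * (t * (6 * K)) = 3 * (κ * Φ (2 * K * t / 2)) := by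
    field_simp; ring
  have h2 := hΦ.mul_le_map_mul (θ := 2 * K) (x := t / 2) (by linarith) (by linarith)
  rw [← mul_div_assoc] at h2
  have h3 := mul_le_mul_of_nonneg_left h2 hκ.le
  have h4 : Real.sqrt 2 ≤ 2 := by rw [Real.sqrt_le_left] <;> norm_num
  have h5 := mul_le_mul_of_nonneg_right h4 (by linarith : 0 ≤ Φ (t / 2))
  have h6 := mul_le_mul_of_nonneg_right hK2 (by linarith : 0 ≤ Φ (t / 2))
  have h7 : κ * Φ 1 ≤ κ * Φ 1 * Φ (t / 2) := le_mul_of_one_le_right (by positivity) hΦt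
  rw [e1]
  linarith
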